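/- Let $d\ge 3$. Let $\mu$ be a measure on $(0,\infty)$ with $\int_{(0,\infty)}(1\wedge t)\,\mu(dt)<\infty$ and $\mu(0,\infty)=\infty$, and put $$\phi(\lambda)=\int_{(0,\infty)}(1-e^{-\lambda t})\,\mu(dt),\qquad H(\lambda)=\phi(\lambda)-\lambda\phi'(\lambda),\qquad \lambda>0.$$ Let $S=(S_t)_{t\ge0}$ be a subordinator with $\mathbb E\,e^{-\lambda S_t}=e^{-t(\lambda+\phi(\lambda))}$ for $\lambda>0$, let $W$ be a Brownian motion in $\mathbb R^d$ started at $0$, independent of $S$, such that $W_t$ has density $p^{(2)}(t,x)=(4\pi t)^{-d/2}e^{-|x|^2/(4t)}$ for $t>0$, and let $X_t=W_{S_t}$. For $t>0$ put $$p(t,x)=\int_{(0,\infty)}(4\pi s)^{-d/2}e^{-|x|^2/(4s)}\,\mathbb P(S_t\in ds).$$ This is the transition density of $X$, i.e. $X_t$ has density $p(t,\cdot)$ for every $t>0$. Let $$G(x)=\int_0^\infty p(t,x)\,dt,\qquad G^{(2)}(x)=\int_0^\infty p^{(2)}(t,x)\,dt,\qquad x\in\mathbb R^d\setminus\{0\},$$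 be the Green functions of $X$ and of the Brownian motion $W$. For functions $f,g\ge 0$ on $\mathbb R^d\setminus\{0\}$, $f\asymp g$ means that there are constants $c_1,c_2\in(0,\infty)$ with $c_1f(x)\le g(x)\le c_2f(x)$ for all $x\ne0$. (i) Suppose that for some $\gamma>0$, $C_L\in(0,1]$, $\delta\in(0,2)$ and $C_U\in[1,\infty)$, $$C_L\,x^{\gamma}\le\frac{H(\lambda x)}{H(\lambda)}\le C_U\,x^{\delta}\qquad\text{for all }\lambda>0,\ x\ge1 .$$ Then $$G(x)\asymp |x|^{-d}\left(|x|^{2}\wedge\phi(|x|^{-2})^{-1}\right),\qquad x\in\mathbb R^d\setminus\{0\}.$$ In particular, if moreover there is a constant $C$ with $\phi(\lambda)\le C\lambda$ for all $\lambda>0$, then $G\asymp G^{(2)}$. (ii) If $\phi(\lambda)=\dfrac{\lambda}{\log(1+\lambda)}-1$ for all $\lambda>0$, then $G\asymp G^{(2)}$. -/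

import Mathlib

open MeasureTheory ProbabilityTheory Set Filter Topology
open scoped ENNReal NNReal

namespace SBM

noncomputable section

/-- `μ` is the Lévy measure of a subordinator: it lives on `(0, ∞)` and
`∫ (1 ∧ t) μ(dt) < ∞`. -/
structure IsLevyMeasure (μ : Measure ℝ) : Prop where
  support : μ (Iic 0) = 0
  finite : ∫⁻ t in Ioi (0 : ℝ), ENNReal.ofReal (min 1 t) ∂μ < ∞

/-- `φ(l) = ∫_{(0,∞)} (1 - e^{-l t}) μ(dt)`. -/
def phi (μ : Measure ℝ) (l : ℝ) : ℝ :=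
  ∫ t in Ioi (0 : ℝ), (1 - Real.exp (-(l * t))) ∂μ

/-- The Laplace exponent with unit drift, `ψ(l) = l + φ(l)`. -/
def psi (μ : Measure ℝ) (l : ℝ) : ℝ := l + phi μ l

/-- `H(l) = φ(l) - l φ'(l)`. -/
def H (μ : Measure ℝ) (l : ℝ) : ℝ := phi μ l - l * deriv (phi μ) l

/-- The lower scaling condition `L_a(γ, C)`. -/
def LowerScaling (f : ℝ → ℝ) (a γ C : ℝ) : Prop :=
  0 ≤ a ∧ 0 < γ ∧ 0 < C ∧ C ≤ 1 ∧
    ∀ l x : ℝ, a < l → 1 ≤ x → C * x ^ γ ≤ f (l * x) / f l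

/-- The upper scaling condition `U_a(δ, C)`. -/
def UpperScaling (f : ℝ → ℝ) (a δ C : ℝ) : Prop :=
  0 ≤ a ∧ 0 < δ ∧ 1 ≤ C ∧
    ∀ l x : ℝ, a < l → 1 ≤ x → f (l * x) / f l ≤ C * x ^ δ

/-- `p⁽²⁾(t, x) = (4 π t)^{-d/2} exp(-|x|² / (4 t))`. -/
def heatKernel (d : ℕ) (t : ℝ) (x : EuclideanSpace ℝ (Fin d)) : ℝ :=
  (4 * Real.pi * t) ^ (-((d : ℝ) / 2)) * Real.exp (-(‖x‖ ^ 2 / (4 * t)))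

variable {Ω : Type*} [MeasurableSpace Ω]

/-- `S` is a subordinator (an increasing Lévy process started at `0`) on the probability space
`(Ω, P)`, whose Laplace exponent is `e`, that is `E exp(-l S_t) = exp(-t e(l))` for `l > 0`. -/
structure IsSubordinator (S : ℝ≥0 → Ω → ℝ≥0) (P : Measure Ω) (e : ℝ → ℝ) : Prop where
  measurable : ∀ t, Measurable (S t)
  zero : ∀ᵐ ω ∂P, S 0 ω = 0
  indep_increments : HasIndepIncrements (fun t ω => (S t ω : ℝ)) P
  stationary_increments : ∀ s t : ℝ≥0,
    P.map (fun ω => (S (s + t) ω : ℝ) - (S s ω : ℝ)) = P.map (fun ω => (S t ω : ℝ))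
  monotone_paths : ∀ᵐ ω ∂P, Monotone fun t => S t ω
  right_continuous_paths : ∀ᵐ ω ∂P, ∀ t, ContinuousWithinAt (fun u => S u ω) (Ici t) t
  laplace : ∀ (t : ℝ≥0) (l : ℝ), 0 < l →
    ∫ ω, Real.exp (-(l * (S t ω : ℝ))) ∂P = Real.exp (-((t : ℝ) * e l))

/-- `W` is a Brownian motion in `ℝ^d` started at `0`, running at the speed for which `W_t` has
density `p⁽²⁾(t, ·)` (characteristic exponent `|ξ|²`). -/
structure IsBrownianMotion {d : ℕ} (W : ℝ≥0 → Ω → EuclideanSpace ℝ (Fin d)) (P : Measure Ω) :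
    Prop where
  measurable : ∀ t, Measurable (W t)
  zero : ∀ᵐ ω ∂P, W 0 ω = 0
  indep_increments : HasIndepIncrements W P
  gaussian_increments : ∀ s t : ℝ≥0, 0 < t →
    P.map (fun ω => W (s + t) ω - W s ω) =
      volume.withDensity fun x => ENNReal.ofReal (heatKernel d t x)
  continuous_paths : ∀ᵐ ω ∂P, Continuous fun t => W t ω

/-- The process `X_t = W_{S_t}`. -/
def subordinate {d : ℕ} (W : ℝ≥0 → Ω → EuclideanSpace ℝ (Fin d)) (S : ℝ≥0 → Ω → ℝ≥0)
    (t : ℝ≥0) (ω : Ω) : EuclideanSpace ℝ (Fin d) :=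
  W (S t ω) ω

/-- `p(t, x) = ∫_{(0,∞)} (4 π s)^{-d/2} e^{-|x|²/(4 s)} P(S_t ∈ ds)`. -/
def transitionDensity (d : ℕ) (S : ℝ≥0 → Ω → ℝ≥0) (P : Measure Ω) (t : ℝ≥0)
    (x : EuclideanSpace ℝ (Fin d)) : ℝ≥0∞ :=
  ∫⁻ s in Ioi (0 : ℝ≥0), ENNReal.ofReal (heatKernel d s x) ∂(P.map (S t))

/-- The Green function `G(x) = ∫_0^∞ p(t, x) dt` of the subordinate Brownian motion. -/
def green (d : ℕ) (S : ℝ≥0 → Ω → ℝ≥0) (P : Measure Ω) (x : EuclideanSpace ℝ (Fin d)) : ℝ≥0∞ :=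
  ∫⁻ t in Ioi (0 : ℝ), transitionDensity d S P t.toNNReal x

/-- The Green function `G⁽²⁾(x) = ∫_0^∞ p⁽²⁾(t, x) dt` of Brownian motion. -/
def brownianGreen (d : ℕ) (x : EuclideanSpace ℝ (Fin d)) : ℝ≥0∞ :=
  ∫⁻ t in Ioi (0 : ℝ), ENNReal.ofReal (heatKernel d t x)

/-- `f(x) ≍ g(x)` for `x ∈ ℝ^d \ {0}`: each is bounded by a finite positive constant times
the other. -/
def Comparable {d : ℕ} (f g : EuclideanSpace ℝ (Fin d) → ℝ≥0∞) : Prop :=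
  ∃ c₁ c₂ : ℝ, 0 < c₁ ∧ 0 < c₂ ∧
    ∀ x, x ≠ 0 → ENNReal.ofReal c₁ * f x ≤ g x ∧ g x ≤ ENNReal.ofReal c₂ * f x

/-- `|x|^{-d} (|x|² ∧ φ(|x|^{-2})^{-1})`. -/
def greenBound (d : ℕ) (μ : Measure ℝ) (x : EuclideanSpace ℝ (Fin d)) : ℝ :=
  (‖x‖ ^ d)⁻¹ * min (‖x‖ ^ 2) (phi μ ((‖x‖ ^ 2)⁻¹))⁻¹

end

end SBM

namespace SBM

/-! ### Bounds for the heat kernel -/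

/-! Write r = |x|², a = d/2 and ψ(l) = l + φ(l). Since max(l, φ(l)) ≤ ψ(l) ≤ 2 max(l, φ(l)), the
estimate in (i) amounts to G(x) ≍ r^{-a}/ψ(1/r). The potential measure ∫ P(S_t ∈ ·) dt has Laplace
transform 1/ψ, so it suffices to compare the heat kernel, as a function of s, with exponentials.

Upper bound (`heatPotential_le`): the kernel is at most C(s + r)^{-a}, a Gamma mixture of the
functions e^{-(s+r)l}. Its potential is a multiple of ∫ l^{a-1} e^{-rl}/ψ(l) dl, and 1/ψ(l) ≤ (1 +
1/(rl))/ψ(1/r). The resulting integrals converge because a > 1.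

Lower bound (`le_heatPotential`): the kernel is at least a multiple of r^{-a} for r/K ≤ s ≤ 6r.
Outside this window e^{-s/r} is dominated by e·e^{-Ks/r} or e^{-3}e^{-s/(2r)}. These corrections
consume at most half of 1/ψ(1/r) once ψ(Kl) ≥ 4eψ(l) for all l.

This growth is immediate if φ is at most linear, because ψ(l) ≥ l. Under lower scaling of H it
follows from (φ(l)/l)' = -H(l)/l² and φ(l)/l → 0, by which φ inherits the scaling
(`IsLevyMeasure.phi_scaling`). The Brownian Green function is the same potential for S_t = t.

The density claim (`map_subordinate`) is separate: round S_t down to a grid, use independence there,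
and pass to the limit along continuous paths. -/

lemma heatKernel_nonneg (d : ℕ) {s : ℝ} (hs : 0 ≤ s) (x : EuclideanSpace ℝ (Fin d)) :
    0 ≤ heatKernel d s x := by
  unfold heatKernel; positivity

/-- Trades the Gaussian factor for polynomial decay in s + |x|², a form that the Gamma integral
turns into exponentials in s. -/
lemma heatKernel_le (d : ℕ) (hd : 1 ≤ d) {s : ℝ} (hs : 0 < s) (x : EuclideanSpace ℝ (Fin d)) :
    heatKernel d s x ≤
      (2 * d : ℝ) ^ ((d : ℝ) / 2) * (s + ‖x‖ ^ 2) ^ (-((d : ℝ) / 2)) := by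
  have hd' : (1 : ℝ) ≤ d := by exact_mod_cast hd
  set r : ℝ := ‖x‖ ^ 2 with hr
  have hr0 : 0 ≤ r := by positivity
  set a : ℝ := (d : ℝ) / 2 with ha
  have ha0 : 0 < a := by positivity
  have h1 : (4 * Real.pi * s) ^ (-a) ≤ s ^ (-a) := by
    apply Real.rpow_le_rpow_of_nonpos hs _ (by linarith)
    nlinarith [Real.pi_gt_three]
  -- The scale 2d is chosen so that the power d/2 turns exp(r/(2ds)) into exactly the Gaussian
  -- exponent r/(4s).
  have h2 : s + r ≤ s * (2 * d) * Real.exp (r / s / (2 * d)) := by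
    have := Real.add_one_le_exp (r / s / (2 * d))
    calc s + r = s * (1 + r / s) := by field_simp
      _ ≤ s * ((2 * d) * (r / s / (2 * d) + 1)) := by
        gcongr
        rw [mul_add, mul_div_cancel₀ _ (by positivity)]
        linarith
      _ ≤ s * ((2 * d) * Real.exp (r / s / (2 * d))) := by gcongr
      _ = _ := by ring
  have h3 : (s + r) ^ a ≤ s ^ a * (2 * d) ^ a * Real.exp (r / (4 * s)) := by
    calc (s + r) ^ a ≤ (s * (2 * d) * Real.exp (r / s / (2 * d))) ^ a :=
          Real.rpow_le_rpow (by positivity) h2 ha0.le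
      _ = s ^ a * (2 * d) ^ a * Real.exp (r / (4 * s)) := by
        rw [Real.mul_rpow (by positivity) (by positivity), Real.mul_rpow hs.le (by positivity),
          ← Real.exp_mul]
        congr 2
        rw [ha]; field_simp; norm_num
  unfold heatKernel
  rw [← hr, ← ha]
  calc (4 * Real.pi * s) ^ (-a) * Real.exp (-(r / (4 * s)))
      ≤ s ^ (-a) * Real.exp (-(r / (4 * s))) := by gcongr
    _ ≤ (2 * d) ^ a * (s + r) ^ (-a) := by
      rw [Real.rpow_neg hs.le, Real.rpow_neg (by positivity), Real.exp_neg, ← mul_inv,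
        ← div_eq_mul_inv, le_div_iff₀ (by positivity), inv_mul_le_iff₀ (by positivity)]
      linarith

lemma le_heatKernel (d : ℕ) {s K B : ℝ} (hB : 0 < B) (hK : 0 < K)
    (x : EuclideanSpace ℝ (Fin d)) (hx : 0 < ‖x‖)
    (h1 : ‖x‖ ^ 2 ≤ K * s) (h2 : s ≤ B * ‖x‖ ^ 2) :
    (4 * Real.pi * B) ^ (-((d : ℝ) / 2)) * Real.exp (-(K / 4)) * (‖x‖ ^ 2) ^ (-((d : ℝ) / 2)) ≤
      heatKernel d s x := by
  have hs : 0 < s := by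
    by_contra h
    have : 0 < ‖x‖ ^ 2 := by positivity
    nlinarith
  have hpi := Real.pi_pos
  unfold heatKernel
  rw [mul_right_comm, ← Real.mul_rpow (by positivity) (by positivity)]
  gcongr ?_ * Real.exp ?_
  · apply Real.rpow_le_rpow_of_nonpos (by positivity) _ (by linarith [Nat.cast_nonneg (α := ℝ) d])
    calc 4 * Real.pi * s ≤ 4 * Real.pi * (B * ‖x‖ ^ 2) := by gcongr
      _ = _ := by ring
  · rw [neg_le_neg_iff, div_le_div_iff₀ (by positivity) (by positivity)]
    linarith

/-! ### Laplace transforms as Lebesgue integrals -/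

lemma lintegral_rpow_mul_exp {a r : ℝ} (ha : 0 < a) (hr : 0 < r) :
    ∫⁻ l in Ioi (0 : ℝ), ENNReal.ofReal (l ^ (a - 1) * Real.exp (-(r * l))) =
      ENNReal.ofReal (Real.Gamma a * r ^ (-a)) := by
  have key := Real.integral_rpow_mul_exp_neg_mul_Ioi ha hr
  have hΓ := Real.Gamma_pos_of_pos ha
  rw [← ofReal_integral_eq_lintegral_ofReal, key]
  · rw [one_div, Real.inv_rpow hr.le, Real.rpow_neg hr.le, mul_comm]
  -- The Bochner integral of a non-integrable function is 0, so a positive value certifies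
  -- integrability.
  · exact .of_integral_ne_zero (by rw [key]; positivity)
  · filter_upwards [ae_restrict_mem measurableSet_Ioi] with l hl
    have : (0 : ℝ) < l := hl
    positivity

lemma lintegral_exp_neg_mul {c : ℝ} (hc : 0 < c) :
    ∫⁻ t in Ioi (0 : ℝ), ENNReal.ofReal (Real.exp (-(t * c))) = ENNReal.ofReal (c⁻¹) := by
  have := lintegral_rpow_mul_exp one_pos hc
  simpa [Real.rpow_neg_one, mul_comm] using this

/-! ### Green function estimates from a Laplace exponent. -/

/-- The family `ν` of laws on `[0, ∞)` has Laplace exponent `ψ`. -/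
def HasLaplaceExponent (ν : ℝ → Measure ℝ≥0) (ψ : ℝ → ℝ) : Prop :=
  ∀ t : ℝ, 0 < t → ∀ l : ℝ, 0 < l →
    ∫⁻ s, ENNReal.ofReal (Real.exp (-(l * (s : ℝ)))) ∂ν t = ENNReal.ofReal (Real.exp (-(t * ψ l)))

/-- The properties of a Laplace exponent with unit drift that the Green function estimates use. -/
structure IsDriftExponent (ψ : ℝ → ℝ) : Prop where
  le : ∀ l, 0 < l → l ≤ ψ l
  monotoneOn : MonotoneOn ψ (Ioi 0)
  mul_le : ∀ l v, 0 < l → 0 < v → v ≤ 1 → v * ψ l ≤ ψ (v * l)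

lemma IsDriftExponent.pos {ψ : ℝ → ℝ} (hψ : IsDriftExponent ψ) {l : ℝ} (hl : 0 < l) : 0 < ψ l :=
  hl.trans_le (hψ.le l hl)

/-- The potential of `ν` applied to the heat kernel. -/
noncomputable def heatPotential (d : ℕ) (ν : ℝ → Measure ℝ≥0) (x : EuclideanSpace ℝ (Fin d)) :
    ℝ≥0∞ :=
  ∫⁻ t in Ioi (0 : ℝ), ∫⁻ s in Ioi (0 : ℝ≥0), ENNReal.ofReal (heatKernel d s x) ∂ν t

/-- The profile `r^{-d/2} / ψ(1/r)`, `r = |x|²`. -/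
noncomputable def profile (d : ℕ) (ψ : ℝ → ℝ) (x : EuclideanSpace ℝ (Fin d)) : ℝ :=
  (‖x‖ ^ 2) ^ (-((d : ℝ) / 2)) * (ψ ((‖x‖ ^ 2)⁻¹))⁻¹

variable {ν : ℝ → Measure ℝ≥0} {ψ : ℝ → ℝ}

/-- The drift gives ψ(l) ≥ l, so the mass at 0 is at most e^{-tl} for every l > 0; let l → ∞. -/
lemma HasLaplaceExponent.measure_zero (hν : HasLaplaceExponent ν ψ) (hψ : IsDriftExponent ψ)
    {t : ℝ} (ht : 0 < t) : ν t {0} = 0 := by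
  have hb : ∀ l : ℝ, 0 < l → ν t {0} ≤ ENNReal.ofReal (Real.exp (-(t * l))) := by
    intro l hl
    calc ν t {0} = ∫⁻ s in ({0} : Set ℝ≥0), ENNReal.ofReal (Real.exp (-(l * (s : ℝ)))) ∂ν t := by
          simp
      _ ≤ ∫⁻ s, ENNReal.ofReal (Real.exp (-(l * (s : ℝ)))) ∂ν t := setLIntegral_le_lintegral _ _
      _ = ENNReal.ofReal (Real.exp (-(t * ψ l))) := hν t ht l hl
      _ ≤ _ := by
        gcongr
        exact hψ.le l hl
  have hlim : Tendsto (fun l : ℝ => ENNReal.ofReal (Real.exp (-(t * l)))) atTop (𝓝 0) := by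
    rw [← ENNReal.ofReal_zero]
    refine ENNReal.tendsto_ofReal (Real.tendsto_exp_neg_atTop_nhds_zero.comp ?_)
    exact tendsto_id.const_mul_atTop ht
  exact le_antisymm (ge_of_tendsto hlim ((eventually_gt_atTop 0).mono hb)) zero_le

lemma HasLaplaceExponent.restrict (hν : HasLaplaceExponent ν ψ) (hψ : IsDriftExponent ψ)
    {t : ℝ} (ht : 0 < t) : (ν t).restrict (Ioi 0) = ν t := by
  refine Measure.restrict_eq_self_of_ae_mem ?_
  have h := hν.measure_zero hψ ht
  have : {0}ᶜ ∈ ae (ν t) := by rwa [mem_ae_iff, compl_compl]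
  filter_upwards [this] with s hs
  exact pos_iff_ne_zero.2 hs

lemma HasLaplaceExponent.setLIntegral (hν : HasLaplaceExponent ν ψ) (hψ : IsDriftExponent ψ)
    {t l u : ℝ} (ht : 0 < t) (hl : 0 < l) (hu : 0 ≤ u) :
    ∫⁻ s in Ioi (0 : ℝ≥0), ENNReal.ofReal (u * Real.exp (-(l * (s : ℝ)))) ∂ν t =
      ENNReal.ofReal u * ENNReal.ofReal (Real.exp (-(t * ψ l))) := by
  simp_rw [ENNReal.ofReal_mul hu]
  rw [lintegral_const_mul _ (by fun_prop), hν.restrict hψ ht, hν t ht l hl]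

/-- Upper Green function estimate. -/
lemma heatPotential_le [∀ t, SFinite (ν t)] (hν : HasLaplaceExponent ν ψ)
    (hψ : IsDriftExponent ψ) (d : ℕ) (hd : 3 ≤ d) :
    ∃ C : ℝ, 0 < C ∧ ∀ x : EuclideanSpace ℝ (Fin d), x ≠ 0 →
      heatPotential d ν x ≤ ENNReal.ofReal (C * profile d ψ x) := by
  have hd' : (3 : ℝ) ≤ d := by exact_mod_cast hd
  set a : ℝ := (d : ℝ) / 2 with ha
  have ha1 : 1 < a := by rw [ha]; linarith
  have hΓ := Real.Gamma_pos_of_pos (show 0 < a by linarith)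
  have hΓ' := Real.Gamma_pos_of_pos (show 0 < a - 1 by linarith)
  set D : ℝ := (2 * d : ℝ) ^ a / Real.Gamma a with hD
  have hD0 : 0 < D := by positivity
  -- The two Gamma values come from the terms 1 and 1/(rl) in the bound for 1/ψ(l).
  refine ⟨D * (Real.Gamma a + Real.Gamma (a - 1)), by positivity, fun x hx => ?_⟩
  have hx0 : 0 < ‖x‖ := norm_pos_iff.2 hx
  set r : ℝ := ‖x‖ ^ 2 with hr
  have hr0 : 0 < r := by positivity
  have hψr := hψ.pos (inv_pos.2 hr0)
  have hψm : AEMeasurable ψ (volume.restrict (Ioi 0)) :=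
    aemeasurable_restrict_of_monotoneOn measurableSet_Ioi hψ.monotoneOn
  have hker : ∀ s : ℝ≥0, 0 < s → ENNReal.ofReal (heatKernel d s x) ≤
      ENNReal.ofReal D * ∫⁻ l in Ioi (0 : ℝ),
        ENNReal.ofReal (l ^ (a - 1) * Real.exp (-((s + r) * l))) := by
    intro s hs
    have hs' : (0 : ℝ) < s := hs
    rw [lintegral_rpow_mul_exp (by linarith) (by positivity), ← ENNReal.ofReal_mul hD0.le]
    apply ENNReal.ofReal_le_ofReal
    refine (heatKernel_le d (by omega) hs' x).trans_eq ?_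
    rw [hD, ← hr, ← ha]; field_simp
  have hone : ∀ t : ℝ, 0 < t →
      ∫⁻ s in Ioi (0 : ℝ≥0), ENNReal.ofReal (heatKernel d s x) ∂ν t ≤
      ENNReal.ofReal D * ∫⁻ l in Ioi (0 : ℝ),
        ENNReal.ofReal (l ^ (a - 1) * Real.exp (-(r * l))) *
          ENNReal.ofReal (Real.exp (-(t * ψ l))) := by
    intro t ht
    calc ∫⁻ s in Ioi (0 : ℝ≥0), ENNReal.ofReal (heatKernel d s x) ∂ν t
        ≤ ∫⁻ s in Ioi (0 : ℝ≥0), ENNReal.ofReal D * (∫⁻ l in Ioi (0 : ℝ),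
          ENNReal.ofReal (l ^ (a - 1) * Real.exp (-((s + r) * l)))) ∂ν t :=
          setLIntegral_mono' measurableSet_Ioi hker
      _ ≤ ∫⁻ s, ENNReal.ofReal D * (∫⁻ l in Ioi (0 : ℝ),
          ENNReal.ofReal (l ^ (a - 1) * Real.exp (-((s + r) * l)))) ∂ν t :=
          setLIntegral_le_lintegral _ _
      _ = ENNReal.ofReal D * ∫⁻ l in Ioi (0 : ℝ), ∫⁻ s,
          ENNReal.ofReal (l ^ (a - 1) * Real.exp (-((s + r) * l))) ∂ν t := by
        rw [lintegral_const_mul' _ _ ENNReal.ofReal_ne_top, lintegral_lintegral_swap]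
        fun_prop
      _ = _ := by
        congr 1
        refine setLIntegral_congr_fun measurableSet_Ioi fun l hl => ?_
        have hl' : (0 : ℝ) < l := hl
        rw [← hν t ht l hl, ← lintegral_const_mul _ (by fun_prop)]
        refine lintegral_congr fun s => ?_
        rw [← ENNReal.ofReal_mul (by positivity), mul_assoc, ← Real.exp_add]
        congr 3
        ring_nf
  -- For rl ≥ 1 this is monotonicity of ψ; for rl ≤ 1 it is the concavity-type bound vψ(1/r) ≤
  -- ψ(v/r) with v = rl.
  have hinv : ∀ l : ℝ, 0 < l → (ψ l)⁻¹ ≤ (1 + (r * l)⁻¹) * (ψ r⁻¹)⁻¹ := by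
    intro l hl
    have hp : 0 < r * l := by positivity
    have hψl := hψ.pos hl
    rw [← div_eq_mul_inv, le_div_iff₀ hψr, inv_mul_le_iff₀ hψl]
    rcases le_total (r * l) 1 with h | h
    · have := hψ.mul_le r⁻¹ (r * l) (inv_pos.2 hr0) hp h
      rw [show r * l * r⁻¹ = l by field_simp] at this
      have h2 : ψ r⁻¹ ≤ (r * l)⁻¹ * ψ l := by
        rw [inv_mul_eq_div, le_div_iff₀ hp]; linarith
      linarith
    · have : ψ r⁻¹ ≤ ψ l := by
        refine hψ.monotoneOn (mem_Ioi.2 (inv_pos.2 hr0)) (mem_Ioi.2 hl) ?_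
        rw [inv_eq_one_div, div_le_iff₀ hr0]; linarith
      have : 0 < (r * l)⁻¹ * ψ l := by positivity
      linarith
  calc heatPotential d ν x
      ≤ ∫⁻ t in Ioi (0 : ℝ), ENNReal.ofReal D * ∫⁻ l in Ioi (0 : ℝ),
        ENNReal.ofReal (l ^ (a - 1) * Real.exp (-(r * l))) *
          ENNReal.ofReal (Real.exp (-(t * ψ l))) := setLIntegral_mono' measurableSet_Ioi hone
    _ = ENNReal.ofReal D * ∫⁻ l in Ioi (0 : ℝ), ∫⁻ t in Ioi (0 : ℝ),
        ENNReal.ofReal (l ^ (a - 1) * Real.exp (-(r * l))) *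
          ENNReal.ofReal (Real.exp (-(t * ψ l))) := by
      rw [lintegral_const_mul' _ _ ENNReal.ofReal_ne_top, lintegral_lintegral_swap]
      have hm : Measurable fun z : ℝ × ℝ =>
        ENNReal.ofReal (z.2 ^ (a - 1) * Real.exp (-(r * z.2))) := by fun_prop
      refine hm.aemeasurable.mul ?_
      exact (Real.measurable_exp.comp_aemeasurable
        (measurable_fst.aemeasurable.mul hψm.comp_snd).neg).ennreal_ofReal
    _ = ENNReal.ofReal D * ∫⁻ l in Ioi (0 : ℝ),
        ENNReal.ofReal (l ^ (a - 1) * Real.exp (-(r * l))) * ENNReal.ofReal (ψ l)⁻¹ := by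
      congr 1
      refine setLIntegral_congr_fun measurableSet_Ioi fun l hl => ?_
      rw [lintegral_const_mul' _ _ ENNReal.ofReal_ne_top, lintegral_exp_neg_mul (hψ.pos hl)]
    _ ≤ ENNReal.ofReal D * ∫⁻ l in Ioi (0 : ℝ), ENNReal.ofReal (ψ r⁻¹)⁻¹ *
        (ENNReal.ofReal (l ^ (a - 1) * Real.exp (-(r * l))) +
          ENNReal.ofReal r⁻¹ * ENNReal.ofReal (l ^ (a - 1 - 1) * Real.exp (-(r * l)))) := by
      refine mul_le_mul_right ?_ _
      refine setLIntegral_mono' measurableSet_Ioi fun l hl => ?_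
      have hl' : (0 : ℝ) < l := hl
      rw [← ENNReal.ofReal_mul (by positivity), ← ENNReal.ofReal_mul (by positivity),
        ← ENNReal.ofReal_add (by positivity) (by positivity),
        ← ENNReal.ofReal_mul (by positivity)]
      apply ENNReal.ofReal_le_ofReal
      calc l ^ (a - 1) * Real.exp (-(r * l)) * (ψ l)⁻¹
          ≤ l ^ (a - 1) * Real.exp (-(r * l)) * ((1 + (r * l)⁻¹) * (ψ r⁻¹)⁻¹) := by
            gcongr
            exact hinv l hl'
        _ = _ := by
          rw [Real.rpow_sub_one hl'.ne' (a - 1)]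
          field_simp
    _ = ENNReal.ofReal (D * (Real.Gamma a + Real.Gamma (a - 1)) * profile d ψ x) := by
      rw [lintegral_const_mul' _ _ ENNReal.ofReal_ne_top, lintegral_add_left (by fun_prop),
        lintegral_const_mul' _ _ ENNReal.ofReal_ne_top,
        lintegral_rpow_mul_exp (by linarith) hr0, lintegral_rpow_mul_exp (by linarith) hr0,
        ← ENNReal.ofReal_mul (by positivity),
        ← ENNReal.ofReal_add (by positivity) (by positivity),
        ← ENNReal.ofReal_mul (by positivity), ← ENNReal.ofReal_mul (by positivity)]
      congr 1
      have : r⁻¹ * (Real.Gamma (a - 1) * r ^ (-(a - 1))) = Real.Gamma (a - 1) * r ^ (-a) := by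
        rw [show -(a - 1) = -a + 1 by ring, Real.rpow_add_one hr0.ne']
        field_simp
      rw [this, profile, ← hr, ← ha]
      ring

/-- Lower Green function estimate, for exponents that grow by a large factor on some scale. -/
lemma le_heatPotential (hν : HasLaplaceExponent ν ψ)
    (hψ : IsDriftExponent ψ) (d : ℕ) {K : ℝ} (hK : 0 < K)
    (hgrow : ∀ l, 0 < l → 4 * Real.exp 1 * ψ l ≤ ψ (K * l)) :
    ∃ c : ℝ, 0 < c ∧ ∀ x : EuclideanSpace ℝ (Fin d), x ≠ 0 →
      ENNReal.ofReal (c * profile d ψ x) ≤ heatPotential d ν x := by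
  set a : ℝ := (d : ℝ) / 2 with ha
  have hpi := Real.pi_pos
  set c : ℝ := (4 * Real.pi * 6) ^ (-a) * Real.exp (-(K / 4)) with hc
  have hc0 : 0 < c := by positivity
  refine ⟨c / 2, by positivity, fun x hx => ?_⟩
  have hx0 : 0 < ‖x‖ := norm_pos_iff.2 hx
  set r : ℝ := ‖x‖ ^ 2 with hr
  have hr0 : 0 < r := by positivity
  have hri : 0 < r⁻¹ := by positivity
  have hψr := hψ.pos hri
  set m : ℝ := c * r ^ (-a) with hm
  have hm0 : 0 < m := by positivity
  have hpot : ∀ u l : ℝ, 0 ≤ u → 0 < l →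
      ∫⁻ t in Ioi (0 : ℝ), ∫⁻ s in Ioi (0 : ℝ≥0),
        ENNReal.ofReal (u * Real.exp (-(l * (s : ℝ)))) ∂ν t = ENNReal.ofReal (u * (ψ l)⁻¹) := by
    intro u l hu hl
    rw [setLIntegral_congr_fun measurableSet_Ioi
      (fun t ht => hν.setLIntegral hψ (mem_Ioi.1 ht) hl hu),
      lintegral_const_mul' _ _ ENNReal.ofReal_ne_top, lintegral_exp_neg_mul (hψ.pos hl),
      ← ENNReal.ofReal_mul hu]
  -- Nothing is assumed about measurability of t ↦ `ν t`; these inner integrals are measurable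
  -- because they agree for t > 0 with an explicit exponential. Additivity below needs this for the
  -- correction terms only.
  have hmeas : ∀ u l : ℝ, 0 ≤ u → 0 < l →
      AEMeasurable (fun t => ∫⁻ s in Ioi (0 : ℝ≥0),
        ENNReal.ofReal (u * Real.exp (-(l * (s : ℝ)))) ∂ν t) (volume.restrict (Ioi 0)) := by
    intro u l hu hl
    have hg : Measurable fun t : ℝ =>
      ENNReal.ofReal u * ENNReal.ofReal (Real.exp (-(t * ψ l))) := by fun_prop
    refine hg.aemeasurable.congr ?_
    filter_upwards [ae_restrict_mem measurableSet_Ioi] with t ht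
    exact (hν.setLIntegral hψ (mem_Ioi.1 ht) hl hu).symm
  -- One term on the right suffices on each range: the second for Ks < r, the third for s > 6r,
  -- where s/r ≥ 3 + s/(2r), and the heat kernel in between.
  have hker : ∀ s : ℝ≥0, 0 < s →
      ENNReal.ofReal (m * Real.exp (-(r⁻¹ * s))) ≤ ENNReal.ofReal (heatKernel d s x) +
        ENNReal.ofReal (m * Real.exp 1 * Real.exp (-(K * r⁻¹ * s))) +
        ENNReal.ofReal (m * Real.exp (-3) * Real.exp (-(2⁻¹ * r⁻¹ * s))) := by
    intro s hs
    have hs' : (0 : ℝ) < s := hs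
    have hh := heatKernel_nonneg d hs'.le x
    rw [← ENNReal.ofReal_add hh (by positivity),
      ← ENNReal.ofReal_add (by positivity) (by positivity)]
    apply ENNReal.ofReal_le_ofReal
    have hA : 0 < m * Real.exp 1 * Real.exp (-(K * r⁻¹ * s)) := by positivity
    have hB : 0 < m * Real.exp (-3) * Real.exp (-(2⁻¹ * r⁻¹ * s)) := by positivity
    have hexp : m * Real.exp (-(r⁻¹ * s)) ≤ m :=
      mul_le_of_le_one_right hm0.le (Real.exp_le_one_iff.2 (by simp; positivity))
    rcases lt_or_ge (K * s) r with h1 | h1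
    · have : m ≤ m * Real.exp 1 * Real.exp (-(K * r⁻¹ * s)) := by
        rw [mul_assoc, ← Real.exp_add]
        refine le_mul_of_one_le_right hm0.le (Real.one_le_exp ?_)
        have : K * r⁻¹ * s ≤ 1 := by
          rw [show K * r⁻¹ * s = K * s / r by ring, div_le_one hr0]; exact h1.le
        linarith
      linarith
    rcases lt_or_ge (6 * r) s with h2 | h2
    · have : m * Real.exp (-(r⁻¹ * s)) ≤ m * Real.exp (-3) * Real.exp (-(2⁻¹ * r⁻¹ * s)) := by
        rw [mul_assoc m, ← Real.exp_add]
        refine mul_le_mul_of_nonneg_left (Real.exp_le_exp.2 ?_) hm0.le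
        have : 6 ≤ r⁻¹ * s := by
          rw [show r⁻¹ * s = s / r by ring, le_div_iff₀ hr0]; exact h2.le
        linarith
      linarith
    · have := le_heatKernel d (by norm_num : (0 : ℝ) < 6) hK x hx0 h1 h2
      rw [← hr, ← ha, ← hc, ← hm] at this
      linarith
  have hint : ENNReal.ofReal (m * (ψ r⁻¹)⁻¹) ≤ heatPotential d ν x +
      ENNReal.ofReal (m * Real.exp 1 * (ψ (K * r⁻¹))⁻¹) +
      ENNReal.ofReal (m * Real.exp (-3) * (ψ (2⁻¹ * r⁻¹))⁻¹) := by
    rw [← hpot _ _ hm0.le hri, ← hpot _ _ (by positivity) (by positivity),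
      ← hpot _ _ (by positivity) (by positivity), heatPotential,
      ← lintegral_add_right' _ (hmeas _ _ (by positivity) (by positivity)),
      ← lintegral_add_right' _ (hmeas _ _ (by positivity) (by positivity))]
    refine setLIntegral_mono' measurableSet_Ioi fun t ht => ?_
    rw [← lintegral_add_right _ (by fun_prop), ← lintegral_add_right _ (by fun_prop)]
    exact setLIntegral_mono' measurableSet_Ioi hker
  have hKr := hψ.pos (show 0 < K * r⁻¹ by positivity)
  have h2r := hψ.pos (show 0 < 2⁻¹ * r⁻¹ by positivity)
  have b1 : m * Real.exp 1 * (ψ (K * r⁻¹))⁻¹ ≤ m * (1 / 4) * (ψ r⁻¹)⁻¹ := by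
    have := hgrow _ hri
    rw [← div_eq_mul_inv (b := ψ _), ← div_eq_mul_inv (b := ψ r⁻¹), div_le_div_iff₀ hKr hψr]
    nlinarith
  have b2 : m * Real.exp (-3) * (ψ (2⁻¹ * r⁻¹))⁻¹ ≤ m * (1 / 4) * (ψ r⁻¹)⁻¹ := by
    have := hψ.mul_le r⁻¹ 2⁻¹ hri (by norm_num) (by norm_num)
    -- Halving the argument of ψ costs a factor 2, so 1/8 leaves the quarter that is needed.
    have he : Real.exp (-3) ≤ 1 / 8 := by
      rw [Real.exp_neg, one_div]
      gcongr
      have h3 : Real.exp 3 = Real.exp 1 ^ 3 := by rw [← Real.exp_nat_mul]; norm_num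
      have h2 : (2 : ℝ) ≤ Real.exp 1 := by linarith [Real.add_one_le_exp (1 : ℝ)]
      rw [h3]
      calc (8 : ℝ) = 2 ^ 3 := by norm_num
        _ ≤ _ := by gcongr
    rw [← div_eq_mul_inv (b := ψ _), ← div_eq_mul_inv (b := ψ r⁻¹), div_le_div_iff₀ h2r hψr]
    calc m * Real.exp (-3) * ψ r⁻¹ ≤ m * (1 / 8) * ψ r⁻¹ := by gcongr
      _ = m * (1 / 4) * (2⁻¹ * ψ r⁻¹) := by ring
      _ ≤ _ := by gcongr
  -- Written as a sum so that the finite half can be cancelled in `ℝ≥0∞`, where subtraction is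
  -- truncated.
  have hsum : ENNReal.ofReal (m * (1 / 2) * (ψ r⁻¹)⁻¹) + ENNReal.ofReal (m * (1 / 2) * (ψ r⁻¹)⁻¹) ≤
      heatPotential d ν x + ENNReal.ofReal (m * (1 / 2) * (ψ r⁻¹)⁻¹) := by
    calc _ = ENNReal.ofReal (m * (ψ r⁻¹)⁻¹) := by
          rw [← ENNReal.ofReal_add (by positivity) (by positivity)]
          congr 1; ring
      _ ≤ _ := hint
      _ ≤ _ := by
        rw [add_assoc, ← ENNReal.ofReal_add (by positivity) (by positivity)]
        gcongr
        linarith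
  have := (ENNReal.add_le_add_iff_right ENNReal.ofReal_ne_top).1 hsum
  refine le_trans (le_of_eq ?_) this
  rw [profile, ← hr, ← ha, hm]
  congr 1; ring

end SBM
namespace SBM

/-! ### Properties of the Laplace exponent -/

variable {μ : Measure ℝ}

lemma IsLevyMeasure.integrable_min (hμ : IsLevyMeasure μ) :
    IntegrableOn (fun t : ℝ => min 1 t) (Ioi 0) μ := by
  refine ⟨by fun_prop, ?_⟩
  rw [hasFiniteIntegral_iff_ofReal]
  · exact hμ.finite
  · filter_upwards [ae_restrict_mem measurableSet_Ioi] with t ht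
    exact le_min zero_le_one (le_of_lt ht)

lemma one_sub_exp_neg_nonneg {y : ℝ} (hy : 0 ≤ y) : 0 ≤ 1 - Real.exp (-y) := by
  have := Real.exp_le_one_iff.2 (neg_nonpos.2 hy); linarith

lemma one_sub_exp_neg_le (y : ℝ) : 1 - Real.exp (-y) ≤ y := by
  have := Real.add_one_le_exp (-y); linarith

lemma one_sub_exp_neg_mul_le {l t : ℝ} (ht : 0 < t) :
    1 - Real.exp (-(l * t)) ≤ max 1 l * min 1 t := by
  rcases le_total 1 t with h | h
  · rw [min_eq_left h, mul_one]
    have := Real.exp_pos (-(l * t))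
    linarith [le_max_left 1 l]
  · rw [min_eq_right h]
    refine (one_sub_exp_neg_le _).trans ?_
    gcongr
    exact le_max_right _ _

lemma IsLevyMeasure.integrable_phi (hμ : IsLevyMeasure μ) {l : ℝ} (hl : 0 < l) :
    IntegrableOn (fun t : ℝ => 1 - Real.exp (-(l * t))) (Ioi 0) μ := by
  refine (hμ.integrable_min.const_mul (max 1 l)).mono' (by fun_prop) ?_
  filter_upwards [ae_restrict_mem measurableSet_Ioi] with t ht
  have ht' : (0 : ℝ) < t := ht
  rw [Real.norm_of_nonneg (one_sub_exp_neg_nonneg (by positivity))]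
  exact one_sub_exp_neg_mul_le ht'

lemma phi_nonneg {l : ℝ} (hl : 0 < l) : 0 ≤ phi μ l := by
  refine setIntegral_nonneg measurableSet_Ioi fun t ht => ?_
  have ht' : (0 : ℝ) < t := ht
  exact one_sub_exp_neg_nonneg (by positivity)

lemma IsLevyMeasure.phi_pos (hμ : IsLevyMeasure μ) (hμ_inf : μ (Ioi 0) = ∞) {l : ℝ} (hl : 0 < l) :
    0 < phi μ l := by
  refine (setIntegral_pos_iff_support_of_nonneg_ae ?_ (hμ.integrable_phi hl)).2 ?_
  · filter_upwards [ae_restrict_mem measurableSet_Ioi] with t ht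
    have ht' : (0 : ℝ) < t := ht
    exact one_sub_exp_neg_nonneg (by positivity)
  · have : (Function.support fun t : ℝ => 1 - Real.exp (-(l * t))) ∩ Ioi 0 = Ioi 0 := by
      refine inter_eq_right.2 fun t ht => ?_
      have ht' : (0 : ℝ) < t := ht
      have : Real.exp (-(l * t)) < 1 := by
        rw [← Real.exp_zero]; exact Real.exp_lt_exp.2 (by simp; positivity)
      exact (sub_pos.2 this).ne'
    rw [this, hμ_inf]
    exact ENNReal.zero_lt_top

lemma IsLevyMeasure.monotoneOn_phi (hμ : IsLevyMeasure μ) : MonotoneOn (phi μ) (Ioi 0) := by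
  intro l hl m hm hlm
  refine setIntegral_mono_on (hμ.integrable_phi hl) (hμ.integrable_phi hm) measurableSet_Ioi
    fun t ht => ?_
  have ht' : (0 : ℝ) < t := ht
  gcongr

/-- Convexity of exp between -y and 0. -/
lemma mul_one_sub_exp_neg_le {v y : ℝ} (hv : 0 ≤ v) (hv1 : v ≤ 1) :
    v * (1 - Real.exp (-y)) ≤ 1 - Real.exp (-(v * y)) := by
  have h := convexOn_exp.2 (mem_univ (-y)) (mem_univ 0) hv (sub_nonneg.2 hv1) (by ring)
  simp only [smul_eq_mul, mul_zero, add_zero, Real.exp_zero, mul_one, mul_neg] at h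
  linarith

lemma IsLevyMeasure.mul_phi_le (hμ : IsLevyMeasure μ) {l v : ℝ} (hl : 0 < l) (hv : 0 < v)
    (hv1 : v ≤ 1) : v * phi μ l ≤ phi μ (v * l) := by
  unfold phi
  rw [← integral_const_mul]
  refine setIntegral_mono_on ((hμ.integrable_phi hl).const_mul v)
    (hμ.integrable_phi (by positivity)) measurableSet_Ioi fun t _ => ?_
  rw [mul_assoc v]
  exact mul_one_sub_exp_neg_le hv.le hv1

lemma IsLevyMeasure.hasDerivAt_phi (hμ : IsLevyMeasure μ) {l : ℝ} (hl : 0 < l) :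
    IntegrableOn (fun t : ℝ => t * Real.exp (-(l * t))) (Ioi 0) μ ∧
      HasDerivAt (phi μ) (∫ t in Ioi (0 : ℝ), t * Real.exp (-(l * t)) ∂μ) l := by
  refine hasDerivAt_integral_of_dominated_loc_of_deriv_le
    -- For m > l/2 one has t e^{-mt} ≤ 1/m ≤ 2/l, which serves for t ≥ 1; for t ≤ 1 the bound t
    -- suffices.
    (bound := fun t => max 1 (2 / l) * min 1 t)
    (F := fun l t => 1 - Real.exp (-(l * t))) (F' := fun l t => t * Real.exp (-(l * t)))
    (Ioi_mem_nhds (half_lt_self hl)) ?_ (hμ.integrable_phi hl) (by fun_prop) ?_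
    (hμ.integrable_min.const_mul _) ?_
  · exact Eventually.of_forall fun m => by fun_prop
  · filter_upwards [ae_restrict_mem measurableSet_Ioi] with t ht m hm
    have ht' : (0 : ℝ) < t := ht
    have hm' : l / 2 < m := hm
    rw [Real.norm_of_nonneg (by positivity)]
    have he : Real.exp (-(m * t)) ≤ 1 := Real.exp_le_one_iff.2 (by simp; nlinarith)
    rcases le_total 1 t with h | h
    · rw [min_eq_left h, mul_one]
      refine le_trans ?_ (le_max_right _ _)
      have h1 : t * m * Real.exp (-(m * t)) ≤ 1 := by
        have := Real.add_one_le_exp (m * t)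
        rw [Real.exp_neg, ← div_eq_mul_inv, div_le_one (Real.exp_pos _)]
        linarith
      rw [le_div_iff₀ hl]
      have : 0 < t * Real.exp (-(m * t)) := by positivity
      nlinarith
    · rw [min_eq_right h]
      calc t * Real.exp (-(m * t)) ≤ t * 1 := by gcongr
        _ = 1 * t := by ring
        _ ≤ _ := by gcongr; exact le_max_left _ _
  · refine Eventually.of_forall fun t m _ => ?_
    have h1 : HasDerivAt (fun m : ℝ => -(m * t)) (-t) m := by
      simpa using! ((hasDerivAt_id m).mul_const t).neg
    have := h1.exp.const_sub 1
    convert this using 1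
    ring

/-- H(l) is the integral of 1 - (1 + lt)e^{-lt}, which is nonnegative since 1 + y ≤ e^y. -/
lemma IsLevyMeasure.H_nonneg (hμ : IsLevyMeasure μ) {l : ℝ} (hl : 0 < l) : 0 ≤ H μ l := by
  obtain ⟨hi, hd⟩ := hμ.hasDerivAt_phi hl
  rw [H, hd.deriv, phi, ← integral_const_mul, ← integral_sub (hμ.integrable_phi hl)
    (hi.const_mul l)]
  refine setIntegral_nonneg measurableSet_Ioi fun t _ => ?_
  have h := Real.add_one_le_exp (l * t)
  have h2 : Real.exp (-(l * t)) * Real.exp (l * t) = 1 := by rw [← Real.exp_add]; simp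
  have h3 := Real.exp_pos (-(l * t))
  nlinarith

/-- φ has no drift part: for l ≥ 1 the integrand divided by l is dominated by min(1, t) and tends to
0 pointwise. -/
lemma IsLevyMeasure.tendsto_phi_div (hμ : IsLevyMeasure μ) :
    Tendsto (fun l => phi μ l / l) atTop (𝓝 0) := by
  have h : Tendsto (fun l : ℝ => ∫ t in Ioi (0 : ℝ), (1 - Real.exp (-(l * t))) / l ∂μ) atTop
      (𝓝 (∫ _ in Ioi (0 : ℝ), (0 : ℝ) ∂μ)) := by
    refine tendsto_integral_filter_of_dominated_convergence (fun t => min 1 t)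
      (Eventually.of_forall fun l => by fun_prop) ?_ hμ.integrable_min ?_
    · filter_upwards [eventually_ge_atTop 1] with l hl
      filter_upwards [ae_restrict_mem measurableSet_Ioi] with t ht
      have ht' : (0 : ℝ) < t := ht
      have hl0 : 0 < l := by linarith
      rw [Real.norm_of_nonneg
        (div_nonneg (one_sub_exp_neg_nonneg (by positivity)) hl0.le), div_le_iff₀ hl0]
      refine (one_sub_exp_neg_mul_le ht').trans ?_
      rw [max_eq_right hl, mul_comm]
    · filter_upwards [ae_restrict_mem measurableSet_Ioi] with t ht
      have ht' : (0 : ℝ) < t := ht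
      refine squeeze_zero' ?_ ?_ tendsto_inv_atTop_zero
      · filter_upwards [eventually_gt_atTop 0] with l hl
        exact div_nonneg (one_sub_exp_neg_nonneg (by positivity)) hl.le
      · filter_upwards [eventually_gt_atTop 0] with l hl
        rw [inv_eq_one_div]
        gcongr
        linarith [Real.exp_pos (-(l * t))]
  simpa [phi, integral_div] using h

/-- Lower scaling of `H` passes to `φ`. -/
lemma IsLevyMeasure.phi_scaling (hμ : IsLevyMeasure μ) {γ C : ℝ}
    (h : LowerScaling (H μ) 0 γ C) {l x : ℝ} (hl : 0 < l) (hx : 1 ≤ x) :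
    C * x ^ γ * phi μ l ≤ phi μ (l * x) := by
  obtain ⟨-, -, hC, -, hscal⟩ := h
  have hx0 : 0 < x := by linarith
  have hc : 0 < C * x ^ γ := by positivity
  set c := C * x ^ γ with hcdef
  have hH : ∀ m : ℝ, 0 < m → c * H μ m ≤ H μ (m * x) := by
    intro m hm
    have h1 := hscal m x hm hx
    -- If H vanished at m, the quotient would be 0 by the convention for division, against its
    -- positive lower bound.
    have h2 : 0 < H μ m := by
      refine lt_of_le_of_ne (hμ.H_nonneg hm) fun h0 => ?_
      rw [← h0, div_zero] at h1
      linarith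
    exact (le_div_iff₀ h2).1 h1
  -- The scaling of H makes F' ≤ 0, and F vanishes at infinity, so F ≥ 0; this is integration of the
  -- inequality for H without writing the integral.
  set F : ℝ → ℝ := fun m => phi μ (m * x) / m - c * (phi μ m / m) with hF
  have hderiv : ∀ m : ℝ, 0 < m →
      HasDerivAt F (-(H μ (m * x) - c * H μ m) / m ^ 2) m := by
    intro m hm
    have d1 := (hμ.hasDerivAt_phi hm).2.differentiableAt.hasDerivAt
    have d2 := (hμ.hasDerivAt_phi (show 0 < m * x by positivity)).2.differentiableAt.hasDerivAt
    have d3 : HasDerivAt (fun m => phi μ (m * x)) (deriv (phi μ) (m * x) * x) m := by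
      have := HasDerivAt.comp m d2 ((hasDerivAt_id m).mul_const x)
      simpa using! this
    have := (d3.div (hasDerivAt_id m) hm.ne').sub ((d1.div (hasDerivAt_id m) hm.ne').const_mul c)
    refine this.congr_deriv ?_
    simp only [H, id_eq]
    field_simp
    ring
  have hanti : AntitoneOn F (Ioi 0) := by
    refine antitoneOn_of_deriv_nonpos (convex_Ioi 0)
      (fun m hm => (hderiv m hm).continuousAt.continuousWithinAt)
      (fun m hm => (hderiv m (by simpa using hm)).differentiableAt.differentiableWithinAt)
      fun m hm => ?_
    have hm' : 0 < m := by simpa using hm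
    rw [(hderiv m hm').deriv]
    have := hH m hm'
    exact div_nonpos_of_nonpos_of_nonneg (by linarith) (by positivity)
  have hlim : Tendsto F atTop (𝓝 0) := by
    have h1 : Tendsto (fun m => x * (phi μ (m * x) / (m * x))) atTop (𝓝 (x * 0)) :=
      (hμ.tendsto_phi_div.comp (tendsto_id.atTop_mul_const hx0)).const_mul x
    have h2 := h1.sub (hμ.tendsto_phi_div.const_mul c)
    simp only [mul_zero, sub_zero] at h2
    refine h2.congr fun m => ?_
    simp only [hF]
    congr 1
    field_simp
  have hFl : 0 ≤ F l := by
    refine le_of_tendsto hlim ?_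
    filter_upwards [eventually_ge_atTop l] with m hm
    exact hanti hl (mem_Ioi.2 (lt_of_lt_of_le hl hm)) hm
  simp only [hF, ← mul_div_assoc, ← sub_div] at hFl
  have := (div_nonneg_iff.1 hFl).resolve_right (by rintro ⟨-, h⟩; linarith)
  linarith

end SBM
namespace SBM

variable {Ω : Type*} [MeasurableSpace Ω]

/-! ### The law of the subordinate Brownian motion -/

/-- The largest multiple of `1 / (n + 1)` that does not exceed `s`. -/
noncomputable def gridFloor (n : ℕ) (s : ℝ≥0) : ℝ≥0 :=
  (⌊s * (n + 1)⌋₊ : ℝ≥0) / (n + 1)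

lemma tendsto_gridFloor (s : ℝ≥0) : Tendsto (fun n => gridFloor n s) atTop (𝓝 s) := by
  have h := (tendsto_nat_floor_mul_div_atTop (R := ℝ) s.2).comp
    (tendsto_natCast_atTop_atTop.comp (tendsto_add_atTop_nat 1))
  rw [← NNReal.tendsto_coe]
  refine h.congr fun n => ?_
  simp only [Function.comp_apply, gridFloor, NNReal.coe_div, NNReal.coe_add, NNReal.coe_natCast,
    NNReal.coe_one, Nat.cast_add, Nat.cast_one, NNReal.val_eq_coe]
  congr 2

variable {d : ℕ} {W : ℝ≥0 → Ω → EuclideanSpace ℝ (Fin d)} {S : ℝ≥0 → Ω → ℝ≥0} {P : Measure Ω}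

/-- Joint measurability of W is not assumed. On the grid only countably many times occur, so
measurability of each `W t` is enough. -/
lemma IsBrownianMotion.measurable_grid (hW : IsBrownianMotion W P) (n : ℕ) {T : Ω → ℝ≥0}
    (hT : Measurable T) : Measurable fun ω => W (gridFloor n (T ω)) ω := by
  have h : Measurable fun z : Ω × ℕ => W ((z.2 : ℝ≥0) / (n + 1)) z.1 :=
    measurable_from_prod_countable_left fun k => hW.measurable ((k : ℝ≥0) / (n + 1))
  have hf : Measurable fun ω => (ω, ⌊T ω * (n + 1)⌋₊) :=
    measurable_id.prodMk (Nat.measurable_floor.comp (hT.mul_const _))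
  have h2 := h.comp hf
  simpa only [gridFloor, Function.comp_def] using h2

lemma IsBrownianMotion.tendsto_grid (hW : IsBrownianMotion W P) (T : Ω → ℝ≥0) :
    ∀ᵐ ω ∂P, Tendsto (fun n => W (gridFloor n (T ω)) ω) atTop (𝓝 (W (T ω) ω)) := by
  filter_upwards [hW.continuous_paths] with ω hω
  exact (hω.tendsto (T ω)).comp (tendsto_gridFloor (T ω))

lemma IsBrownianMotion.aemeasurable_subordinate (hW : IsBrownianMotion W P) {t : ℝ≥0}
    (hS : Measurable (S t)) : AEMeasurable (subordinate W S t) P :=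
  aemeasurable_of_tendsto_metrizable_ae atTop
    (fun n => (hW.measurable_grid n hS).aemeasurable) (hW.tendsto_grid (S t))

lemma IsBrownianMotion.lintegral_eq (hW : IsBrownianMotion W P) {s : ℝ≥0} (hs : 0 < s)
    {f : EuclideanSpace ℝ (Fin d) → ℝ≥0∞} (hf : Measurable f) :
    ∫⁻ ω, f (W s ω) ∂P = ∫⁻ x, ENNReal.ofReal (heatKernel d s x) * f x := by
  have hk : Measurable fun x => ENNReal.ofReal (heatKernel d s x) := by
    unfold heatKernel
    fun_prop
  have h := hW.gaussian_increments 0 s hs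
  rw [zero_add] at h
  have hwd := lintegral_withDensity_eq_lintegral_mul volume hk hf
  rw [← h, lintegral_map hf (g := fun ω => W s ω - W 0 ω)
    ((hW.measurable s).sub (hW.measurable 0))] at hwd
  refine Eq.trans ?_ hwd
  refine lintegral_congr_ae ?_
  filter_upwards [hW.zero] with ω hω
  simp [hω]

variable [IsProbabilityMeasure P]

lemma lintegral_grid (hW : IsBrownianMotion W P)
    (hWS : IndepFun (fun ω t => W t ω) (fun ω t => S t ω) P) {t : ℝ≥0} (hS : Measurable (S t))
    (n : ℕ) {f : EuclideanSpace ℝ (Fin d) → ℝ≥0∞} (hf : Measurable f) :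
    ∫⁻ ω, f (W (gridFloor n (S t ω)) ω) ∂P =
      ∫⁻ s, ∫⁻ ω, f (W (gridFloor n s) ω) ∂P ∂(P.map (S t)) := by
  -- Keeping only the grid times leaves a countable family, on which evaluation at a random index is
  -- jointly measurable and Fubini applies.
  let Y : Ω → ℕ → EuclideanSpace ℝ (Fin d) := fun ω k => W ((k : ℝ≥0) / (n + 1)) ω
  let N : ℝ≥0 → ℕ := fun s => ⌊s * (n + 1)⌋₊
  have hY : Measurable Y := measurable_pi_iff.2 fun k => hW.measurable _
  have hN : Measurable N := Nat.measurable_floor.comp (measurable_id.mul_const _)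
  have hφ : Measurable fun (w : ℝ≥0 → EuclideanSpace ℝ (Fin d)) (k : ℕ) =>
      w ((k : ℝ≥0) / (n + 1)) := measurable_pi_iff.2 fun k => measurable_pi_apply _
  have hψ : Measurable fun u : ℝ≥0 → ℝ≥0 => u t := measurable_pi_apply t
  have hind : IndepFun Y (S t) P := hWS.comp hφ hψ
  have hg : Measurable fun z : (ℕ → EuclideanSpace ℝ (Fin d)) × ℝ≥0 => f (z.1 (N z.2)) := by
    have h1 : Measurable fun z : (ℕ → EuclideanSpace ℝ (Fin d)) × ℕ => f (z.1 z.2) :=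
      measurable_from_prod_countable_left fun k => hf.comp (measurable_pi_apply k)
    exact h1.comp (measurable_fst.prodMk (hN.comp measurable_snd))
  have hlaw := (indepFun_iff_map_prod_eq_prod_map_map hY.aemeasurable hS.aemeasurable).1 hind
  have : IsProbabilityMeasure (P.map (S t)) := Measure.isProbabilityMeasure_map hS.aemeasurable
  have : IsProbabilityMeasure (P.map Y) := Measure.isProbabilityMeasure_map hY.aemeasurable
  calc ∫⁻ ω, f (W (gridFloor n (S t ω)) ω) ∂P
      = ∫⁻ z, f (z.1 (N z.2)) ∂(P.map fun ω => (Y ω, S t ω)) := by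
        rw [lintegral_map hg (hY.prodMk hS)]
        rfl
    _ = ∫⁻ s, ∫⁻ y, f (y (N s)) ∂(P.map Y) ∂(P.map (S t)) := by
      rw [hlaw, lintegral_prod_symm _ hg.aemeasurable]
    _ = _ := by
      refine lintegral_congr fun s => ?_
      have hev : Measurable fun y : ℕ → EuclideanSpace ℝ (Fin d) => f (y (N s)) :=
        hf.comp (measurable_pi_apply _)
      rw [lintegral_map hev hY]
      rfl

lemma lintegral_subordinate (hW : IsBrownianMotion W P)
    (hWS : IndepFun (fun ω t => W t ω) (fun ω t => S t ω) P) {t : ℝ≥0} (hS : Measurable (S t))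
    (f : BoundedContinuousFunction (EuclideanSpace ℝ (Fin d)) ℝ≥0) :
    ∫⁻ ω, f (subordinate W S t ω) ∂P = ∫⁻ s, ∫⁻ ω, f (W s ω) ∂P ∂(P.map (S t)) := by
  have : IsProbabilityMeasure (P.map (S t)) := Measure.isProbabilityMeasure_map hS.aemeasurable
  obtain ⟨B, hB⟩ : ∃ B : ℝ≥0, ∀ x, (f x : ℝ≥0∞) ≤ B := by
    exact ⟨nndist f 0, fun x => by exact_mod_cast BoundedContinuousFunction.NNReal.upper_bound f x⟩
  have hfm : Measurable fun x => (f x : ℝ≥0∞) :=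
    measurable_coe_nnreal_ennreal.comp f.continuous.measurable
  have hfc : Continuous fun x => (f x : ℝ≥0∞) := ENNReal.continuous_coe.comp f.continuous
  have hbound : ∀ (Q : Measure Ω) [IsProbabilityMeasure Q] (Z : Ω → EuclideanSpace ℝ (Fin d)),
      ∫⁻ ω, (f (Z ω) : ℝ≥0∞) ∂Q ≤ B := fun Q _ Z =>
    (lintegral_mono fun ω => hB (Z ω)).trans (by simp)
  have h1 : Tendsto (fun n => ∫⁻ ω, (f (W (gridFloor n (S t ω)) ω) : ℝ≥0∞) ∂P) atTop
      (𝓝 (∫⁻ ω, f (subordinate W S t ω) ∂P)) := by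
    refine tendsto_lintegral_of_dominated_convergence (fun _ => B)
      (fun n => hfm.comp (hW.measurable_grid n hS))
      (fun n => Eventually.of_forall fun ω => hB _) (by simp) ?_
    filter_upwards [hW.tendsto_grid (S t)] with ω hω
    exact (hfc.tendsto _).comp hω
  have h2 : Tendsto (fun n => ∫⁻ s, ∫⁻ ω, (f (W (gridFloor n s) ω) : ℝ≥0∞) ∂P ∂(P.map (S t))) atTop
      (𝓝 (∫⁻ s, ∫⁻ ω, f (W s ω) ∂P ∂(P.map (S t)))) := by
    refine tendsto_lintegral_of_dominated_convergence (fun _ => B) (fun n => ?_)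
      (fun n => Eventually.of_forall fun s => hbound P _) (by simp)
      (Eventually.of_forall fun s => ?_)
    · have h3 : Measurable fun k : ℕ => ∫⁻ ω, (f (W ((k : ℝ≥0) / (n + 1)) ω) : ℝ≥0∞) ∂P :=
        measurable_from_top
      exact h3.comp (Nat.measurable_floor.comp (measurable_id.mul_const ((n : ℝ≥0) + 1)))
    · refine tendsto_lintegral_of_dominated_convergence (fun _ => B)
        (fun n => hfm.comp (hW.measurable _))
        (fun n => Eventually.of_forall fun ω => hB _) (by simp) ?_
      filter_upwards [hW.tendsto_grid fun _ => s] with ω hω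
      exact (hfc.tendsto _).comp hω
  refine tendsto_nhds_unique h1 (h2.congr fun n => ?_)
  exact (lintegral_grid hW hWS hS n hfm).symm

/-- `p(t, ·)` is the density of `X_t = W_{S_t}`. -/
lemma map_subordinate (hW : IsBrownianMotion W P)
    (hWS : IndepFun (fun ω t => W t ω) (fun ω t => S t ω) P) {t : ℝ≥0} (hS : Measurable (S t))
    (hpos : (P.map (S t)).restrict (Ioi 0) = P.map (S t)) :
    P.map (subordinate W S t) = volume.withDensity (transitionDensity d S P t) := by
  have : IsProbabilityMeasure (P.map (S t)) := Measure.isProbabilityMeasure_map hS.aemeasurable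
  have hX := hW.aemeasurable_subordinate hS
  have : IsProbabilityMeasure (P.map (subordinate W S t)) := Measure.isProbabilityMeasure_map hX
  have hk : Measurable fun z : ℝ≥0 × EuclideanSpace ℝ (Fin d) =>
      ENNReal.ofReal (heatKernel d z.1 z.2) := by
    unfold heatKernel
    fun_prop
  refine ext_of_forall_lintegral_eq_of_IsFiniteMeasure fun f => ?_
  have hfm : Measurable fun x => (f x : ℝ≥0∞) :=
    measurable_coe_nnreal_ennreal.comp f.continuous.measurable
  have hp : Measurable (transitionDensity d S P t) := hk.lintegral_prod_left'
  rw [lintegral_map' hfm.aemeasurable hX, lintegral_subordinate hW hWS hS,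
    lintegral_withDensity_eq_lintegral_mul _ hp hfm]
  calc ∫⁻ s, ∫⁻ ω, f (W s ω) ∂P ∂(P.map (S t))
      -- Time 0 has to be discarded first, since the Gaussian law of W_s is available only for s >
      -- 0.
      = ∫⁻ s in Ioi 0, ∫⁻ ω, f (W s ω) ∂P ∂(P.map (S t)) := by rw [hpos]
    _ = ∫⁻ s in Ioi 0, ∫⁻ x, ENNReal.ofReal (heatKernel d s x) * f x ∂volume ∂(P.map (S t)) :=
      setLIntegral_congr_fun measurableSet_Ioi fun s hs => hW.lintegral_eq hs hfm
    _ = ∫⁻ x, ∫⁻ s in Ioi 0, ENNReal.ofReal (heatKernel d s x) * f x ∂(P.map (S t)) :=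
      lintegral_lintegral_swap (hk.mul (hfm.comp measurable_snd)).aemeasurable
    _ = _ := by
      refine lintegral_congr fun x => ?_
      rw [lintegral_mul_const' _ _ ENNReal.coe_ne_top]
      rfl

end SBM
namespace SBM

/-! ### Comparability -/

section Comparable

variable {d : ℕ} {f g h : EuclideanSpace ℝ (Fin d) → ℝ≥0∞}

lemma Comparable.symm (hfg : Comparable f g) : Comparable g f := by
  obtain ⟨c₁, c₂, h₁, h₂, H⟩ := hfg
  refine ⟨c₂⁻¹, c₁⁻¹, inv_pos.2 h₂, inv_pos.2 h₁, fun x hx => ?_⟩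
  have e₁ : ENNReal.ofReal c₁ ≠ 0 := (ENNReal.ofReal_pos.2 h₁).ne'
  have e₂ : ENNReal.ofReal c₂ ≠ 0 := (ENNReal.ofReal_pos.2 h₂).ne'
  rw [ENNReal.ofReal_inv_of_pos h₁, ENNReal.ofReal_inv_of_pos h₂]
  exact ⟨(ENNReal.inv_mul_le_iff e₂ ENNReal.ofReal_ne_top).2 (H x hx).2,
    (ENNReal.mul_le_iff_le_inv e₁ ENNReal.ofReal_ne_top).1 (H x hx).1⟩

lemma Comparable.trans (hfg : Comparable f g) (hgh : Comparable g h) : Comparable f h := by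
  obtain ⟨c₁, c₂, h₁, h₂, H⟩ := hfg
  obtain ⟨b₁, b₂, k₁, k₂, K⟩ := hgh
  refine ⟨b₁ * c₁, b₂ * c₂, by positivity, by positivity, fun x hx => ⟨?_, ?_⟩⟩
  · rw [ENNReal.ofReal_mul k₁.le, mul_assoc]
    exact le_trans (by gcongr; exact (H x hx).1) (K x hx).1
  · rw [ENNReal.ofReal_mul k₂.le, mul_assoc]
    exact (K x hx).2.trans (by gcongr; exact (H x hx).2)

lemma comparable_ofReal {u v : EuclideanSpace ℝ (Fin d) → ℝ} {c₁ c₂ : ℝ} (h₁ : 0 < c₁)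
    (h₂ : 0 < c₂) (H : ∀ x, x ≠ 0 → c₁ * u x ≤ v x ∧ v x ≤ c₂ * u x) :
    Comparable (fun x => ENNReal.ofReal (u x)) (fun x => ENNReal.ofReal (v x)) := by
  refine ⟨c₁, c₂, h₁, h₂, fun x hx => ?_⟩
  simp only
  rw [← ENNReal.ofReal_mul h₁.le, ← ENNReal.ofReal_mul h₂.le]
  exact ⟨ENNReal.ofReal_le_ofReal (H x hx).1, ENNReal.ofReal_le_ofReal (H x hx).2⟩

end Comparable

lemma comparable_heatPotential {ν : ℝ → Measure ℝ≥0} [∀ t, SFinite (ν t)] {ψ : ℝ → ℝ}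
    (hν : HasLaplaceExponent ν ψ) (hψ : IsDriftExponent ψ) {d : ℕ} (hd : 3 ≤ d) {K : ℝ}
    (hK : 0 < K) (hgrow : ∀ l, 0 < l → 4 * Real.exp 1 * ψ l ≤ ψ (K * l)) :
    Comparable (fun x => ENNReal.ofReal (profile d ψ x)) (heatPotential d ν) := by
  obtain ⟨C, hC, hup⟩ := heatPotential_le hν hψ d hd
  obtain ⟨c, hc, hlow⟩ := le_heatPotential hν hψ d hK hgrow
  refine ⟨c, C, hc, hC, fun x hx => ?_⟩
  simp only
  rw [← ENNReal.ofReal_mul hc.le, ← ENNReal.ofReal_mul hC.le]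
  exact ⟨hlow x hx, hup x hx⟩

/-! ### Brownian motion -/

lemma isDriftExponent_id : IsDriftExponent fun l => l where
  le _ _ := le_rfl
  monotoneOn := monotoneOn_id
  mul_le _ _ _ _ _ := le_rfl

/-- Brownian motion is the deterministic time change S_t = t, so the general estimates also cover
its Green function. -/
lemma hasLaplaceExponent_dirac :
    HasLaplaceExponent (fun t => Measure.dirac t.toNNReal) fun l => l := by
  intro t ht l _
  rw [lintegral_dirac, Real.coe_toNNReal t ht.le, mul_comm]

lemma brownianGreen_eq (d : ℕ) (x : EuclideanSpace ℝ (Fin d)) :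
    brownianGreen d x = heatPotential d (fun t => Measure.dirac t.toNNReal) x := by
  refine setLIntegral_congr_fun measurableSet_Ioi fun t ht => ?_
  have ht' : (0 : ℝ) < t := ht
  simp only
  rw [hasLaplaceExponent_dirac.restrict isDriftExponent_id ht', lintegral_dirac,
    Real.coe_toNNReal t ht'.le]

lemma comparable_brownianGreen {d : ℕ} (hd : 3 ≤ d) :
    Comparable (fun x => ENNReal.ofReal (profile d (fun l => l) x)) (brownianGreen d) := by
  rw [funext (brownianGreen_eq d)]
  exact comparable_heatPotential hasLaplaceExponent_dirac isDriftExponent_id hd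
    (K := 4 * Real.exp 1) (by positivity) fun _ _ => le_rfl

lemma comparable_profile_of_linear {ψ : ℝ → ℝ} (hψ : IsDriftExponent ψ) (d : ℕ) {M : ℝ}
    (hM : 0 < M) (hlin : ∀ l, 0 < l → ψ l ≤ M * l) :
    Comparable (fun x => ENNReal.ofReal (profile d (fun l => l) x))
      (fun x : EuclideanSpace ℝ (Fin d) => ENNReal.ofReal (profile d ψ x)) := by
  refine comparable_ofReal (inv_pos.2 hM) one_pos fun x hx => ?_
  have hr : 0 < (‖x‖ ^ 2)⁻¹ := by have := norm_pos_iff.2 hx; positivity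
  have hp := hψ.pos hr
  simp only [profile]
  constructor
  · rw [mul_left_comm, ← mul_inv]
    gcongr
    exact hlin _ hr
  · rw [one_mul]
    gcongr
    exact hψ.le _ hr

/-! ### The subordinator -/

section Subordinator

variable {μ : Measure ℝ} {Ω : Type*} [MeasurableSpace Ω] {P : Measure Ω} {S : ℝ≥0 → Ω → ℝ≥0}

lemma IsLevyMeasure.isDriftExponent_psi (hμ : IsLevyMeasure μ) : IsDriftExponent (psi μ) where
  le l hl := le_add_of_nonneg_right (phi_nonneg hl)
  monotoneOn l hl m hm hlm := add_le_add hlm (hμ.monotoneOn_phi hl hm hlm)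
  mul_le l v hl hv hv1 := by
    have := hμ.mul_phi_le hl hv hv1
    simp only [psi, mul_add]
    linarith

lemma IsSubordinator.hasLaplaceExponent [IsProbabilityMeasure P] {e : ℝ → ℝ}
    (hS : IsSubordinator S P e) :
    HasLaplaceExponent (fun t => P.map (S t.toNNReal)) e := by
  intro t ht l hl
  rw [lintegral_map (by fun_prop) (hS.measurable _), ← ofReal_integral_eq_lintegral_ofReal,
    hS.laplace _ l hl, Real.coe_toNNReal t ht.le]
  · have hm := hS.measurable t.toNNReal
    refine Integrable.of_bound (C := 1) (by fun_prop) (Eventually.of_forall fun ω => ?_)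
    rw [Real.norm_of_nonneg (Real.exp_pos _).le, Real.exp_le_one_iff, neg_nonpos]
    positivity
  · exact Eventually.of_forall fun ω => (Real.exp_pos _).le

lemma comparable_green [IsProbabilityMeasure P] (hμ : IsLevyMeasure μ)
    (hS : IsSubordinator S P (psi μ)) {d : ℕ} (hd : 3 ≤ d) {K : ℝ} (hK : 0 < K)
    (hgrow : ∀ l, 0 < l → 4 * Real.exp 1 * psi μ l ≤ psi μ (K * l)) :
    Comparable (fun x => ENNReal.ofReal (profile d (psi μ) x)) (green d S P) := by
  have : ∀ t : ℝ, IsProbabilityMeasure (P.map (S t.toNNReal)) := fun t =>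
    Measure.isProbabilityMeasure_map (hS.measurable _).aemeasurable
  exact comparable_heatPotential hS.hasLaplaceExponent hμ.isDriftExponent_psi hd hK hgrow

/-- If `φ` is at most linear, the Green function is comparable to the Brownian one. -/
lemma comparable_green_of_linear [IsProbabilityMeasure P] (hμ : IsLevyMeasure μ)
    (hS : IsSubordinator S P (psi μ)) {d : ℕ} (hd : 3 ≤ d) {C : ℝ}
    (hC : ∀ l, 0 < l → phi μ l ≤ C * l) : Comparable (brownianGreen d) (green d S P) := by
  have hC0 : 0 ≤ C := by
    have := (phi_nonneg (μ := μ) one_pos).trans (hC 1 one_pos)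
    linarith
  have hψ := hμ.isDriftExponent_psi
  have hlin : ∀ l, 0 < l → psi μ l ≤ (1 + C) * l := fun l hl => by
    have := hC l hl
    rw [psi]; linarith
  refine (comparable_brownianGreen hd).symm.trans
    -- This K works because ψ(Kl) ≥ Kl = 4e(1 + C)l ≥ 4eψ(l).
    ((comparable_profile_of_linear hψ d (by positivity) hlin).trans
      (comparable_green hμ hS hd (K := 4 * Real.exp 1 * (1 + C)) (by positivity) fun l hl => ?_))
  refine le_trans ?_ (hψ.le _ (by positivity))
  rw [mul_assoc (4 * Real.exp 1) (1 + C) l]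
  exact mul_le_mul_of_nonneg_left (hlin l hl) (by positivity)

lemma comparable_greenBound_profile (hμ : IsLevyMeasure μ) (hμ_inf : μ (Ioi 0) = ∞) (d : ℕ) :
    Comparable (fun x : EuclideanSpace ℝ (Fin d) => ENNReal.ofReal (greenBound d μ x))
      (fun x => ENNReal.ofReal (profile d (psi μ) x)) := by
  refine comparable_ofReal (c₁ := 2⁻¹) (c₂ := 1) (by norm_num) one_pos fun x hx => ?_
  have hx0 : 0 < ‖x‖ := norm_pos_iff.2 hx
  have hpow : (‖x‖ ^ 2) ^ (-((d : ℝ) / 2)) = (‖x‖ ^ d)⁻¹ := by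
    rw [← Real.rpow_natCast, ← Real.rpow_mul hx0.le, ← Real.rpow_natCast, ← Real.rpow_neg hx0.le]
    congr 1
    push_cast
    ring
  have hr : 0 < (‖x‖ ^ 2)⁻¹ := by positivity
  have hφ := hμ.phi_pos hμ_inf hr
  rw [greenBound, profile, hpow, psi]
  set l := (‖x‖ ^ 2)⁻¹ with hl
  have hl' : ‖x‖ ^ 2 = l⁻¹ := by rw [hl, inv_inv]
  rw [hl']
  constructor
  · rw [mul_left_comm]
    refine mul_le_mul_of_nonneg_left ?_ (by positivity)
    rcases le_total l (phi μ l) with h | h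
    · calc 2⁻¹ * min l⁻¹ (phi μ l)⁻¹ ≤ 2⁻¹ * (phi μ l)⁻¹ := by gcongr; exact min_le_right _ _
        _ = (2 * phi μ l)⁻¹ := by rw [mul_inv]
        _ ≤ _ := by gcongr; linarith
    · calc 2⁻¹ * min l⁻¹ (phi μ l)⁻¹ ≤ 2⁻¹ * l⁻¹ := by gcongr; exact min_le_left _ _
        _ = (2 * l)⁻¹ := by rw [mul_inv]
        _ ≤ _ := by gcongr; linarith
  · rw [one_mul]
    refine mul_le_mul_of_nonneg_left (le_min ?_ ?_) (by positivity) <;> gcongr <;> linarith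

lemma IsLevyMeasure.exists_psi_growth (hμ : IsLevyMeasure μ) {γ C : ℝ}
    (h : LowerScaling (H μ) 0 γ C) :
    ∃ K : ℝ, 0 < K ∧ ∀ l, 0 < l → 4 * Real.exp 1 * psi μ l ≤ psi μ (K * l) := by
  have hlim : Tendsto (fun K : ℝ => C * K ^ γ) atTop atTop :=
    (tendsto_rpow_atTop h.2.1).const_mul_atTop h.2.2.1
  -- CK^γ ≥ 4e handles φ, K ≥ 4e handles the drift, and K ≥ 1 permits use of the scaling.
  obtain ⟨K, h1, h2, h3⟩ := ((hlim.eventually_ge_atTop (4 * Real.exp 1)).and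
    ((eventually_ge_atTop (1 : ℝ)).and (eventually_ge_atTop (4 * Real.exp 1)))).exists
  refine ⟨K, by linarith, fun l hl => ?_⟩
  have hφ := hμ.phi_scaling h hl h2
  rw [mul_comm l K] at hφ
  rw [psi, psi, mul_add]
  refine add_le_add (by gcongr) (le_trans ?_ hφ)
  exact mul_le_mul_of_nonneg_right h1 (phi_nonneg hl)

end Subordinator

/-- Equivalent to log(1 + l) ≥ l/(1 + l), which is log y ≥ 1 - 1/y at y = 1 + l. Thus the example
has at most linear φ. -/
lemma div_log_one_add_sub_one_le {l : ℝ} (hl : 0 < l) : l / Real.log (1 + l) - 1 ≤ 1 * l := by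
  have hlog : 0 < Real.log (1 + l) := Real.log_pos (by linarith)
  have h := Real.one_sub_inv_le_log_of_pos (show 0 < 1 + l by linarith)
  rw [one_mul, sub_le_iff_le_add, div_le_iff₀ hlog]
  calc l = (l + 1) * (1 - (1 + l)⁻¹) := by field_simp; ring
    _ ≤ _ := by gcongr

end SBM

theorem corollary1p3 (d : ℕ) (hd : 3 ≤ d)
    (μ : Measure ℝ) (hμ : SBM.IsLevyMeasure μ) (hμ_inf : μ (Ioi 0) = ∞)
    {Ω : Type*} [MeasurableSpace Ω] (P : Measure Ω) [IsProbabilityMeasure P]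
    (S : ℝ≥0 → Ω → ℝ≥0) (hS : SBM.IsSubordinator S P (SBM.psi μ))
    (W : ℝ≥0 → Ω → EuclideanSpace ℝ (Fin d)) (hW : SBM.IsBrownianMotion W P)
    (hWS : IndepFun (fun ω t => W t ω) (fun ω t => S t ω) P) :
    -- `p` is the transition density of the subordinate Brownian motion `X_t = W_{S_t}`
    (∀ t : ℝ≥0, 0 < t →
      AEMeasurable (SBM.subordinate W S t) P ∧
      P.map (SBM.subordinate W S t) =
        volume.withDensity (SBM.transitionDensity d S P t)) ∧
    -- the Green function estimate, and its consequence when `φ` is at most linear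
    (∀ γ C_L δ C_U : ℝ, δ < 2 →
      SBM.LowerScaling (SBM.H μ) 0 γ C_L → SBM.UpperScaling (SBM.H μ) 0 δ C_U →
        SBM.Comparable (fun x => ENNReal.ofReal (SBM.greenBound d μ x)) (SBM.green d S P) ∧
        ((∃ C : ℝ, ∀ l : ℝ, 0 < l → SBM.phi μ l ≤ C * l) →
          SBM.Comparable (SBM.brownianGreen d) (SBM.green d S P))) ∧
    -- the example `φ(l) = l / log (1 + l) - 1`
    ((∀ l : ℝ, 0 < l → SBM.phi μ l = l / Real.log (1 + l) - 1) →
      SBM.Comparable (SBM.brownianGreen d) (SBM.green d S P)) := by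
  refine ⟨fun t ht => ⟨hW.aemeasurable_subordinate (hS.measurable t), ?_⟩,
    fun γ C_L δ C_U _ hL _ => ⟨?_, ?_⟩, fun h => ?_⟩
  · refine SBM.map_subordinate hW hWS (hS.measurable t) ?_
    have := hS.hasLaplaceExponent.restrict hμ.isDriftExponent_psi (t := t)
      (NNReal.coe_pos.2 ht)
    simpa only [Real.toNNReal_coe] using this
  · obtain ⟨K, hK, hgrow⟩ := hμ.exists_psi_growth hL
    exact (SBM.comparable_greenBound_profile hμ hμ_inf d).trans
      (SBM.comparable_green hμ hS hd hK hgrow)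
  · rintro ⟨C, hC⟩
    exact SBM.comparable_green_of_linear hμ hS hd hC
  · refine SBM.comparable_green_of_linear hμ hS hd (C := 1) fun l hl => ?_
    rw [h l hl]
    exact SBM.div_log_one_add_sub_one_le hl
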